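/- A hypergraph on a finite vertex set $V$ is a multiset of edges, each of which is a multi-subset of $V$; the degree of a vertex is the total number of its occurrences among all edges. Let $n>h\ge 1$ be integers and let $K_n^h$ be the complete $h$-uniform hypergraph on an $n$-element vertex set $V$, whose edges are all the $h$-subsets of $V$, each taken once. A connected $2$-factorization of $K_n^h$ is a partition of its edge set into classes such that each class, viewed as a hypergraph on the full vertex set $V$, is connected and has all vertex degrees equal to $2$. Then $K_n^h$ has a connected $2$-factorization if and only if $\binom{n-1}{h-1}$ is even and $h$ divides $2n$. In the case $h=2$ (so $n\ge 3$), moreover, the edge set of the complete graph $K_n$ can be partitioned into Hamiltonian cycles if and only if $n$ is odd (Walecki's theorem). -/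

import Mathlib

/-- A hypergraph on the vertex set `V`: a multiset of edges, each of which is a multi-subset
of `V`. -/
@[ext]
structure MultiHypergraph (V : Type*) where
  /-- The edge multiset. -/
  edges : Multiset (Multiset V)

namespace MultiHypergraph

/-- The degree of `v`: the total number of occurrences of `v` among all edges. -/
def degree {V : Type*} [DecidableEq V] (G : MultiHypergraph V) (v : V) : ℕ :=
  (G.edges.map (fun e => e.count v)).sum

/-- Every vertex has degree `r`. -/
def IsRegular {V : Type*} [DecidableEq V] (G : MultiHypergraph V) (r : ℕ) : Prop :=
  ∀ v : V, G.degree v = r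

/-- Two vertices are linked if some edge contains both of them. -/
def Linked {V : Type*} (G : MultiHypergraph V) (u v : V) : Prop :=
  ∃ e ∈ G.edges, u ∈ e ∧ v ∈ e

/-- A hypergraph is connected if it has a vertex and any two vertices are joined by a path, that is,
by a finite sequence of vertices in which any two consecutive ones lie in a common edge. -/
def IsConnected {V : Type*} (G : MultiHypergraph V) : Prop :=
  Nonempty V ∧ ∀ u v : V, Relation.ReflTransGen G.Linked u v

/-- `F` is an `r`-factor of `G`: an `r`-regular spanning sub-hypergraph (it has the same vertex set
`V`, and its edges are among those of `G`, counted with multiplicity). -/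
def IsFactor {V : Type*} [DecidableEq V] (r : ℕ) (F G : MultiHypergraph V) : Prop :=
  F.edges ≤ G.edges ∧ F.IsRegular r

/-- `F` is an `(r i)`-factorization of `G`: the edge multiset of `G` is partitioned into the edge
multisets of the `F i`, and `F i` is an `r i`-factor of `G`. -/
def IsFactorization {V : Type*} [DecidableEq V] {k : ℕ} (r : Fin k → ℕ)
    (F : Fin k → MultiHypergraph V) (G : MultiHypergraph V) : Prop :=
  (∑ i, (F i).edges = G.edges) ∧ ∀ i, IsFactor (r i) (F i) G

/-- `G` has an `r`-factorization each of whose factors is a connected hypergraph. -/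
def IsConnectedFactorizable {V : Type*} [DecidableEq V] (r : ℕ) (G : MultiHypergraph V) : Prop :=
  ∃ (k : ℕ) (F : Fin k → MultiHypergraph V),
    IsFactorization (fun _ => r) F G ∧ ∀ i, (F i).IsConnected

/-- The complete `h`-uniform hypergraph on `V`: every `h`-subset of `V` is an edge exactly once. -/
def complete (V : Type*) [Fintype V] (h : ℕ) : MultiHypergraph V where
  edges := ((Finset.univ : Finset V).powersetCard h).val.map Finset.val

end MultiHypergraph

/-- The edge set of the graph `G` can be partitioned into (the edge sets of) Hamiltonian cycles
of `G`. -/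
def HasHamiltonianDecomposition {V : Type*} [DecidableEq V] (G : SimpleGraph V) :
    Prop :=
  ∃ (k : ℕ) (a : Fin k → V) (c : ∀ i, G.Walk (a i) (a i)),
    (∀ i, (c i).IsHamiltonianCycle) ∧ ∀ e ∈ G.edgeSet, ∃! i, e ∈ (c i).edges

/-! Necessity is counting. The degree of the complete hypergraph is twice the number of factors, and
the handshake lemma in one factor gives `h ∣ 2 * n`.

Sufficiency is by amalgamation and detachment. Glue all `n` vertices into one, so that each edge is
`h` hinges at that point, and colour the edges in classes of size `2 * n / h`. Then split off the
true vertices one by one. With `r + 1` vertices still glued, an edge with `t` remaining hinges gets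
weight `t / (r + 1)`, the share due to the next vertex. The weights sum to 2 on each colour and to a
binomial coefficient on each class of edges with the same trace `S e` on the vertices already split
off. Both totals are integers, so they survive rounding to a 0/1 choice of the edges that receive
the new vertex (`exists_finset_rounding`). This works because colours and traces are two partitions,
and the weights form a flow between them.

Connectedness comes from sending the flow through the components of each colour. A component of
weight at most 1 then contributes at most one chosen edge. This preserves the invariant that every
component keeps at least two hinges (`HasTwoHinges`). When one glued vertex is left, each colour has
only two hinges, hence one component.

For `h = 2`, a connected 2-factor is a Hamiltonian cycle. -/

/-! ### Integral rounding of flows -/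

open Finset in
/-- A nonzero rational flow change supported on a nonempty set `B` of arcs such that no node meets
`B` in exactly one arc end. -/
theorem exists_ne_zero_circulation {A N : Type*} [Fintype A] [Fintype N] [DecidableEq A]
    [DecidableEq N]
    (M : N → A → ℤ) (hcol : ∀ a, ∑ v, M v a = 0) (habs : ∀ a, ∑ v, |M v a| ≤ 2)
    (B : Finset A) (hB : B.Nonempty)
    (hdeg : ∀ v, (∃ a ∈ B, M v a ≠ 0) → 2 ≤ ∑ a ∈ B, |M v a|) :
    ∃ d : A → ℚ, d ≠ 0 ∧ (∀ a ∉ B, d a = 0) ∧ ∀ v, ∑ a, M v a * d a = 0 := by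
  classical
  set P : Finset N := {v | ∃ a ∈ B, M v a ≠ 0} with hP
  -- Double counting of arc ends: at least two at each node of `P`, at most two on each arc.
  have hcard : #P ≤ #B := by
    have h1 : ∑ v ∈ P, (2 : ℤ) ≤ ∑ v ∈ P, ∑ a ∈ B, |M v a| :=
      sum_le_sum fun v hv => hdeg v (by simpa [hP] using hv)
    have h2 : ∑ v ∈ P, ∑ a ∈ B, |M v a| ≤ ∑ v, ∑ a ∈ B, |M v a| :=
      sum_le_sum_of_subset_of_nonneg (subset_univ _)
        fun v _ _ => sum_nonneg fun a _ => abs_nonneg _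
    have h3 : ∑ v, ∑ a ∈ B, |M v a| ≤ ∑ a ∈ B, (2 : ℤ) := by
      rw [sum_comm]; exact sum_le_sum fun a _ => habs a
    simp only [sum_const, nsmul_eq_mul] at h1 h3
    have : (#P : ℤ) ≤ #B := by linarith
    exact_mod_cast this
  -- Dropping one node leaves fewer equations than unknowns. The dropped equation follows from the
  -- others, as the columns of `M` sum to zero.
  obtain ⟨Q, hQcard, hQ⟩ : ∃ Q ⊆ P, #Q < #B ∧ #(P \ Q) ≤ 1 := by
    rcases P.eq_empty_or_nonempty with h0 | ⟨v, hv⟩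
    · exact ⟨∅, by simp, by simpa using hB.card_pos, by simp [h0]⟩
    · refine ⟨P.erase v, erase_subset _ _, ?_, ?_⟩
      · have := card_erase_lt_of_mem hv; omega
      · rw [sdiff_erase_self hv, card_singleton]
  let φ : (B → ℚ) →ₗ[ℚ] (Q → ℚ) :=
    LinearMap.pi fun v => ∑ a : B, (M v.1 a.1 : ℚ) • LinearMap.proj a
  have hker : LinearMap.ker φ ≠ ⊥ := LinearMap.ker_ne_bot_of_finrank_lt (by simpa using hQ.1)
  obtain ⟨d, hd, hd0⟩ := (Submodule.ne_bot_iff _).1 hker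
  set D : A → ℚ := fun a => if h : a ∈ B then d ⟨a, h⟩ else 0 with hD
  have hDsum : ∀ v, ∑ a, M v a * D a = ∑ a : B, M v a.1 * d a := by
    intro v
    rw [← sum_subset (subset_univ B), ← sum_coe_sort B]
    · exact sum_congr rfl fun a _ => by simp [hD]
    · intro a _ ha; simp [hD, ha]
  have hz : ∀ v ∉ P \ Q, ∑ a, M v a * D a = 0 := by
    intro v hv
    rw [hDsum]
    by_cases hvQ : v ∈ Q
    · have := congrFun (LinearMap.mem_ker.1 hd) ⟨v, hvQ⟩
      simpa [φ] using this
    · have hvP : v ∉ P := fun h => hv (mem_sdiff.2 ⟨h, hvQ⟩)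
      refine sum_eq_zero fun a _ => ?_
      have : M v a = 0 := by
        by_contra h
        exact hvP (by simpa [hP] using ⟨a.1, a.2, h⟩)
      simp [this]
  refine ⟨D, ?_, fun a ha => by simp [hD, ha], fun v => ?_⟩
  · intro h
    apply hd0
    ext a
    simpa [hD] using congrFun h a.1
  · by_cases hv : v ∈ P \ Q
    · have htot : ∑ v, ∑ a, M v a * D a = 0 := by
        rw [sum_comm]
        refine sum_eq_zero fun a _ => ?_
        rw [← sum_mul]
        have : (∑ v, (M v a : ℚ)) = 0 := by exact_mod_cast hcol a
        rw [this, zero_mul]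
      rw [← htot]
      refine (sum_eq_single v (fun u _ huv => hz u fun hu => huv ?_) (by simp)).symm
      exact card_le_one.1 hQ.2 u hu v hv
    · exact hz v hv

open Finset in
/-- An incidence row that carries exactly one non-integral arc value cannot have integral total. -/
theorem two_le_sum_abs_of_fract_ne_zero {A : Type*} [Fintype A] (m : A → ℤ) (f : A → ℚ)
    (b : ℤ) (hf : ∑ a, m a * f a = b) (h : ∃ a, Int.fract (f a) ≠ 0 ∧ m a ≠ 0) :
    2 ≤ ∑ a with Int.fract (f a) ≠ 0, |m a| := by
  classical
  obtain ⟨a, ha, hma⟩ := h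
  by_contra! hlt
  set B : Finset A := {a | Int.fract (f a) ≠ 0} with hB
  have haB : a ∈ B := by simpa [hB] using ha
  have hpos : 1 ≤ |m a| := Int.one_le_abs hma
  rw [← add_sum_erase _ _ haB] at hlt
  have hnn : 0 ≤ ∑ x ∈ B.erase a, |m x| := sum_nonneg fun _ _ => abs_nonneg _
  have hone : |m a| = 1 := by omega
  have hrest : ∑ x ∈ B.erase a, |m x| = 0 := by omega
  have hzero : ∀ x ∈ B.erase a, m x = 0 := fun x hx =>
    abs_eq_zero.1 ((sum_eq_zero_iff_of_nonneg fun _ _ => abs_nonneg _).1 hrest x hx)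
  have hfr : ∑ x, m x * Int.fract (f x) = m a * Int.fract (f a) := by
    refine sum_eq_single a (fun x _ hxa => ?_) (by simp)
    by_cases hx : x ∈ B
    · rw [hzero x (mem_erase.2 ⟨hxa, hx⟩)]; simp
    · have : Int.fract (f x) = 0 := by simpa [hB] using hx
      rw [this, mul_zero]
  -- Subtracting the integral parts leaves an integer, yet it is plus or minus a number strictly
  -- between 0 and 1.
  have hint : m a * Int.fract (f a) = ((b - ∑ x, m x * ⌊f x⌋ : ℤ) : ℚ) := by
    rw [← hfr]
    push_cast
    rw [← hf, ← sum_sub_distrib]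
    exact sum_congr rfl fun x _ => by rw [Int.fract]; ring
  have h0 : 0 < Int.fract (f a) := lt_of_le_of_ne (Int.fract_nonneg _) (Ne.symm ha)
  have h1 := Int.fract_lt_one (f a)
  rcases (abs_eq (by norm_num : (0 : ℤ) ≤ 1)).1 hone with h | h
  all_goals
    rw [h] at hint
    generalize b - ∑ x, m x * ⌊f x⌋ = z at hint
    push_cast at hint
  · have l1 : (0 : ℚ) < z := by linarith
    have l2 : (z : ℚ) < 1 := by linarith
    norm_cast at l1 l2
    omega
  · have l1 : (z : ℚ) < 0 := by linarith
    have l2 : (-1 : ℚ) < z := by linarith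
    norm_cast at l1 l2
    omega

open Finset in
/-- Moving from `f` in direction `d` until some coordinate becomes integral. -/
theorem exists_step_to_integral {A : Type*} [Fintype A] (f d : A → ℚ) (hd : d ≠ 0) :
    ∃ τ : ℚ, (∀ a, (⌊f a⌋ : ℚ) ≤ f a + τ * d a ∧ f a + τ * d a ≤ ⌈f a⌉) ∧
      ∃ a, d a ≠ 0 ∧ Int.fract (f a + τ * d a) = 0 := by
  classical
  have hne : ({a | d a ≠ 0} : Finset A).Nonempty := by
    obtain ⟨a, ha⟩ := Function.ne_iff.1 hd
    exact ⟨a, by simpa using ha⟩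
  -- The time at which coordinate `a` reaches its ceiling or floor. Where `d a = 0` the quotient is
  -- 0 by convention, but the minimum is taken only over the support of `d`.
  set T : A → ℚ := fun a => if 0 < d a then (⌈f a⌉ - f a) / d a else (⌊f a⌋ - f a) / d a with hT
  obtain ⟨a₀, ha₀, hmin⟩ := exists_min_image _ T hne
  have ha₀' : d a₀ ≠ 0 := by simpa using ha₀
  have hTnn : ∀ a, 0 ≤ T a := by
    intro a
    simp only [hT]
    split_ifs with h
    · exact div_nonneg (by linarith [Int.le_ceil (f a)]) h.le
    · exact div_nonneg_of_nonpos (by linarith [Int.floor_le (f a)]) (not_lt.1 h)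
  refine ⟨T a₀, fun a => ?_, a₀, ha₀', ?_⟩
  · have hfl := Int.floor_le (f a)
    have hce := Int.le_ceil (f a)
    have h0 := hTnn a₀
    rcases lt_trichotomy (d a) 0 with h | h | h
    · have hle := hmin a (by simp [h.ne])
      simp only [hT, if_neg h.not_gt] at hle
      rw [le_div_iff_of_neg h] at hle
      have : T a₀ * d a ≤ 0 := mul_nonpos_of_nonneg_of_nonpos h0 h.le
      constructor
      · simp only [hT]; linarith
      · linarith
    · rw [h]; constructor <;> linarith
    · have hle := hmin a (by simp [h.ne'])
      simp only [hT, if_pos h] at hle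
      rw [le_div_iff₀ h] at hle
      have : 0 ≤ T a₀ * d a := mul_nonneg h0 h.le
      constructor
      · linarith
      · simp only [hT]; linarith
  · simp only [hT]
    split_ifs with h
    · rw [div_mul_cancel₀ _ ha₀']; simp
    · rw [div_mul_cancel₀ _ ha₀']; simp

open Finset in
/-- **Integral rounding of flows.** If `M` has columns of zero sum and absolute sum at most two
and `M f` is integral, then `f` can be rounded to an integral vector with the same image. -/
theorem exists_integral_rounding {A N : Type*} [Fintype A] [Fintype N]
    (M : N → A → ℤ) (hcol : ∀ a, ∑ v, M v a = 0) (habs : ∀ a, ∑ v, |M v a| ≤ 2) (b : N → ℤ)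
    (f : A → ℚ) (hf : ∀ v, ∑ a, M v a * f a = b v) :
    ∃ g : A → ℤ, (∀ v, ∑ a, M v a * g a = b v) ∧ ∀ a, ⌊f a⌋ ≤ g a ∧ g a ≤ ⌈f a⌉ := by
  classical
  induction hk : #{a | Int.fract (f a) ≠ 0} using Nat.strong_induction_on generalizing f with
  | _ k ih =>
  rcases ({a | Int.fract (f a) ≠ 0} : Finset A).eq_empty_or_nonempty with h0 | hne
  · have hint : ∀ a, (⌊f a⌋ : ℚ) = f a := by
      intro a
      have : Int.fract (f a) = 0 := by
        by_contra h
        exact notMem_empty a (h0 ▸ (by simpa using h))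
      rw [Int.fract] at this
      linarith
    refine ⟨fun a => ⌊f a⌋, fun v => ?_, fun a => ⟨le_rfl, Int.floor_le_ceil _⟩⟩
    have : ∑ a, (M v a : ℚ) * (⌊f a⌋ : ℚ) = b v := by
      rw [← hf v]
      exact sum_congr rfl fun a _ => by rw [hint]
    exact_mod_cast this
  · obtain ⟨d, hd0, hdB, hdM⟩ := exists_ne_zero_circulation M hcol habs _ hne fun v hv =>
      two_le_sum_abs_of_fract_ne_zero (M v) f (b v) (hf v) (by simpa using hv)
    -- Integral coordinates do not move, so the number of fractional ones drops.
    have hsupp : ∀ a, Int.fract (f a) = 0 → d a = 0 := fun a ha => hdB a (by simp [ha])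
    obtain ⟨τ, hτ, a₀, ha₀, hfr⟩ := exists_step_to_integral f d hd0
    have hlt : #{a | Int.fract (f a + τ * d a) ≠ 0} < k := by
      rw [← hk]
      refine card_lt_card ⟨fun a ha => ?_, fun hs => ?_⟩
      · simp only [mem_filter, mem_univ, true_and] at ha ⊢
        intro h
        rw [hsupp a h] at ha
        simp [h] at ha
      · have := hs (by simpa using fun h => ha₀ (hsupp a₀ h) : a₀ ∈ _)
        simp only [mem_filter, mem_univ, true_and] at this
        exact this hfr
    obtain ⟨g, hg, hgf⟩ := ih _ hlt (fun a => f a + τ * d a) (fun v => by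
      simp only [mul_add, sum_add_distrib, hf v]
      have : ∑ a, (M v a : ℚ) * (τ * d a) = τ * ∑ a, M v a * d a := by
        rw [mul_sum]; exact sum_congr rfl fun a _ => by ring
      rw [this, hdM v]; ring) rfl
    exact ⟨g, hg, fun a => ⟨(Int.le_floor.2 (hτ a).1).trans (hgf a).1,
      (hgf a).2.trans (Int.ceil_le.2 (hτ a).2)⟩⟩

open Finset in
/-- Rounding a weight function on `E` with respect to a partition into groups and a partition into
colours that is refined by a partition into components. -/
theorem exists_finset_rounding {E C K S : Type*} [Fintype E] [Fintype C] [Fintype K] [Fintype S]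
    [DecidableEq C] [DecidableEq K] [DecidableEq S]
    (c : E → C) (k : C → K) (s : E → S) (x : E → ℚ) (hx0 : ∀ e, 0 ≤ x e) (hx1 : ∀ e, x e ≤ 1)
    (p : K → ℕ) (q : S → ℕ) (hp : ∀ i, ∑ e with k (c e) = i, x e = p i)
    (hq : ∀ j, ∑ e with s e = j, x e = q j) :
    ∃ X : Finset E, (∀ i, #{e ∈ X | k (c e) = i} = p i) ∧ (∀ j, #{e ∈ X | s e = j} = q j) ∧
      ∀ u, (#{e ∈ X | c e = u} : ℤ) ≤ ⌈∑ e with c e = u, x e⌉ := by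
  classical
  -- The network: `e` is an arc from the group `s e` to the component `c e`, and each component `u`
  -- has an arc to its colour `k u`. The groups supply `q`, the colours demand `p`, and the rounded
  -- arc of `u` yields the ceiling bound.
  let M : (K ⊕ C) ⊕ S → C ⊕ E → ℤ := Sum.elim
    (Sum.elim (fun i => Sum.elim (fun u => if k u = i then 1 else 0) fun _ => 0)
      fun u => Sum.elim (fun u' => if u' = u then -1 else 0) fun e => if c e = u then 1 else 0)
    fun j => Sum.elim (fun _ => 0) fun e => if s e = j then -1 else 0
  let b : (K ⊕ C) ⊕ S → ℤ := Sum.elim (Sum.elim (fun i => p i) fun _ => 0) fun j => -q j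
  let f : C ⊕ E → ℚ := Sum.elim (fun u => ∑ e with c e = u, x e) x
  obtain ⟨g, hg, hgf⟩ := exists_integral_rounding M
    (by rintro (u | e) <;> simp [M, Fintype.sum_sum_type])
    (by rintro (u | e) <;> simp [M, Fintype.sum_sum_type, apply_ite abs]) b f
    (by
      rintro ((i | u) | j)
      · have : ∑ u with k u = i, ∑ e with c e = u, x e = ∑ e with k (c e) = i, x e := by
          rw [← sum_fiberwise_of_maps_to (s := {e | k (c e) = i}) (t := {u | k u = i}) (g := c)
            (by simp)]
          refine sum_congr rfl fun u hu => sum_congr ?_ fun _ _ => rfl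
          ext e
          simp only [mem_filter, mem_univ, true_and] at hu ⊢
          exact ⟨fun h => ⟨by rw [h, hu], h⟩, fun h => h.2⟩
        simpa [M, b, f, Fintype.sum_sum_type, ← sum_filter, this] using hp i
      · simp [M, b, f, Fintype.sum_sum_type, sum_filter]
      · simpa [M, b, f, Fintype.sum_sum_type, ← sum_filter] using hq j)
  have hg01 : ∀ e, g (.inr e) = if g (.inr e) = 1 then 1 else 0 := by
    intro e
    have h1 := (hgf (.inr e)).1
    have h2 := (hgf (.inr e)).2
    have h3 : 0 ≤ ⌊f (.inr e)⌋ := Int.floor_nonneg.2 (hx0 e)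
    have h4 : ⌈f (.inr e)⌉ ≤ 1 := Int.ceil_le.2 (by simpa [f] using hx1 e)
    split_ifs <;> omega
  have hcard : ∀ (P : E → Prop) [DecidablePred P],
      (#{e ∈ ({e | g (.inr e) = 1} : Finset E) | P e} : ℤ) = ∑ e with P e, g (.inr e) := by
    intro P _
    rw [sum_congr rfl fun e _ => hg01 e, ← sum_filter, filter_filter, filter_filter]
    simp [and_comm]
  have hcomp : ∀ u, ∑ e with c e = u, g (.inr e) = g (.inl u) := by
    intro u
    have := hg (.inl (.inr u))
    simp only [M, b, Fintype.sum_sum_type, Sum.elim_inl, Sum.elim_inr, ite_mul, zero_mul, one_mul,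
      sum_ite_eq', mem_univ, if_true, neg_mul, ← sum_filter] at this
    linarith
  refine ⟨({e | g (.inr e) = 1} : Finset E), fun i => ?_, fun j => ?_, fun u => ?_⟩
  · have := hg (.inl (.inl i))
    simp only [M, b, Fintype.sum_sum_type, Sum.elim_inl, Sum.elim_inr, ite_mul, zero_mul, one_mul,
      sum_const_zero, add_zero, ← sum_filter, ← hcomp] at this
    zify
    rw [hcard, ← this, ← sum_fiberwise_of_maps_to (s := {e | k (c e) = i}) (t := {u | k u = i})
      (g := c) (by simp)]
    refine sum_congr rfl fun u hu => sum_congr ?_ fun _ _ => rfl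
    ext e
    simp only [mem_filter, mem_univ, true_and] at hu ⊢
    exact ⟨fun h => h.2, fun h => ⟨by rw [h, hu], h⟩⟩
  · have := hg (.inr j)
    simp only [M, b, Fintype.sum_sum_type, Sum.elim_inl, Sum.elim_inr, ite_mul, zero_mul, neg_mul,
      one_mul, sum_const_zero, zero_add, ← sum_filter, sum_neg_distrib, neg_inj] at this
    zify
    rw [hcard, this]
  · rw [hcard, hcomp]
    exact (hgf (.inl u)).2

/-! ### Amalgamated factorizations and components of colour classes -/

/-- A set of edges is saturated if it is closed under passing to an edge of the same colour that
shares a vertex. -/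
def IsSaturated {E K V : Type*} (col : E → K) (S : E → Finset V) (X : Finset E) : Prop :=
  ∀ e ∈ X, ∀ e', col e = col e' → ¬ Disjoint (S e) (S e') → e' ∈ X

open Finset in
/-- The state of the construction in which the vertices in `L` have been split off and `r` vertices
remain amalgamated: edge `e` meets `L` in `S e`, and has `h - #(S e)` hinges elsewhere. -/
structure IsPartialFactorization {E K V : Type*} [Fintype E] [DecidableEq K]
    [DecidableEq V] (h r : ℕ) (col : E → K) (L : Finset V) (S : E → Finset V) : Prop where
  subset : ∀ e, S e ⊆ L
  count : ∀ T ⊆ L, #{e | S e = T} = if #T ≤ h then r.choose (h - #T) else 0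
  degree : ∀ i, ∀ v ∈ L, #{e | col e = i ∧ v ∈ S e} = 2
  hinges : ∀ i, ∑ e with col e = i, (h - #(S e)) = 2 * r

open Finset in
/-- Each component of each colour class on the split-off vertices has at least two hinges at the
amalgamated vertex. -/
def HasTwoHinges {E K V : Type*} (h : ℕ) (col : E → K) (S : E → Finset V) : Prop :=
  ∀ X : Finset E, X.Nonempty → IsSaturated col S X → 2 ≤ ∑ e ∈ X, (h - #(S e))

/-- Two edges of the same colour that share a vertex are adjacent. -/
def edgeAdj {E K V : Type*} (col : E → K) (S : E → Finset V) (e e' : E) : Prop :=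
  col e = col e' ∧ ¬ Disjoint (S e) (S e')

section

variable {E K V : Type*} {col : E → K} {S : E → Finset V}

theorem IsSaturated.mem_iff {X : Finset E} (hX : IsSaturated col S X) {e e' : E}
    (h : Relation.EqvGen (edgeAdj col S) e e') : e ∈ X ↔ e' ∈ X := by
  induction h with
  | rel a b h =>
    exact ⟨fun ha => hX a ha b h.1 h.2, fun hb => hX b hb a h.1.symm fun hd => h.2 hd.symm⟩
  | refl => rfl
  | symm _ _ _ ih => exact ih.symm
  | trans _ _ _ _ _ ih₁ ih₂ => exact ih₁.trans ih₂

theorem col_eq_of_eqvGen {e e' : E} (h : Relation.EqvGen (edgeAdj col S) e e') :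
    col e = col e' := by
  induction h with
  | rel a b h => exact h.1
  | refl => rfl
  | symm _ _ _ ih => exact ih.symm
  | trans _ _ _ _ _ ih₁ ih₂ => exact ih₁.trans ih₂

open Classical in
/-- The component of an edge. -/
noncomputable def edgeComponent [Fintype E] (col : E → K) (S : E → Finset V) (e : E) : Finset E :=
  {e' | Relation.EqvGen (edgeAdj col S) e e'}

theorem mem_edgeComponent [Fintype E] {e e' : E} :
    e' ∈ edgeComponent col S e ↔ Relation.EqvGen (edgeAdj col S) e e' := by
  simp [edgeComponent]

theorem isSaturated_edgeComponent [Fintype E] (e : E) :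
    IsSaturated col S (edgeComponent col S e) := by
  intro a ha b hab hd
  rw [mem_edgeComponent] at *
  exact ha.trans _ _ _ (.rel _ _ ⟨hab, hd⟩)

theorem self_mem_edgeComponent [Fintype E] (e : E) : e ∈ edgeComponent col S e :=
  mem_edgeComponent.2 (.refl _)

theorem IsSaturated.edgeComponent_subset [Fintype E] {X : Finset E} (hX : IsSaturated col S X)
    {e : E} (he : e ∈ X) : edgeComponent col S e ⊆ X := fun _ h =>
  (hX.mem_iff (mem_edgeComponent.1 h)).1 he

/-- Enlarging the traces only creates adjacencies, so saturation passes back to the state before a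
split. -/
theorem IsSaturated.mono {S' : E → Finset V} {X : Finset E} (hX : IsSaturated col S' X)
    (h : ∀ e, S e ⊆ S' e) : IsSaturated col S X := fun e he e' hc hd =>
  hX e he e' hc fun hd' => hd (hd'.mono (h e) (h e'))

-- Adjacency is symmetric and preserves colour. Thus the two-hinge condition can be applied to a
-- piece of a colour class and to its complement.
open Finset in
theorem IsSaturated.color_sdiff [Fintype E] [DecidableEq K] [DecidableEq E] {X : Finset E}
    (hX : IsSaturated col S X) (i : K) :
    IsSaturated col S (({e | col e = i} : Finset E) \ X) := by
  intro e he e' hc hd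
  simp only [mem_sdiff, mem_filter, mem_univ, true_and] at *
  exact ⟨hc ▸ he.1, fun h => he.2 (hX e' h e hc.symm fun h' => hd h'.symm)⟩

end

/-! ### Splitting off vertices -/

section

open Finset

variable {E K V : Type*} [Fintype E] [DecidableEq K] [DecidableEq V] {h r : ℕ}
  {col : E → K} {L : Finset V} {S : E → Finset V}

/-- The trace of `e` is attained, so its binomial coefficient is nonzero. The second bound makes the
weights at most 1. -/
theorem IsPartialFactorization.card_le (H : IsPartialFactorization h r col L S) (e : E) :
    #(S e) ≤ h ∧ h - #(S e) ≤ r := by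
  have h1 := H.count (S e) (H.subset e)
  have h2 : 0 < #{e' | S e' = S e} := card_pos.2 ⟨e, by simp⟩
  rw [h1] at h2
  split_ifs at h2 with h3
  · exact ⟨h3, by_contra fun h4 => by
      rw [Nat.choose_eq_zero_of_lt (not_le.1 h4)] at h2; exact lt_irrefl _ h2⟩
  · exact absurd h2 (lt_irrefl _)

/-- The edges that receive the next vertex. -/
theorem IsPartialFactorization.exists_selection [Fintype K] [Fintype V]
    (H : IsPartialFactorization h (r + 1) col L S) :
    ∃ X : Finset E, (∀ i, #{e ∈ X | col e = i} = 2) ∧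
      (∀ T ⊆ L, #{e ∈ X | S e = T} = if #T < h then r.choose (h - #T - 1) else 0) ∧
      ∀ e ∈ X, ∀ e' ∈ X, e ≠ e' → e' ∈ edgeComponent col S e →
        r + 1 < ∑ a ∈ edgeComponent col S e, (h - #(S a)) := by
  classical
  have hr : (0 : ℚ) < (r + 1 : ℕ) := by positivity
  let st : Setoid E := Relation.EqvGen.setoid (edgeAdj col S)
  -- The fair share of the next vertex among the `r + 1` vertices still amalgamated.
  let x : E → ℚ := fun e => (h - #(S e) : ℕ) / (r + 1 : ℕ)
  have hsum : ∀ Y : Finset E, ∑ e ∈ Y, x e = (∑ e ∈ Y, (h - #(S e)) : ℕ) / (r + 1 : ℕ) := by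
    intro Y
    simp only [x]
    rw [← sum_div]
    push_cast
    rfl
  have hq : ∀ T, ∑ e with S e = T, x e =
      ((if T ⊆ L ∧ #T < h then r.choose (h - #T - 1) else 0 : ℕ) : ℚ) := by
    intro T
    rw [hsum, div_eq_iff hr.ne', sum_congr rfl (g := fun _ => h - #T)
      (by intro e he; rw [(mem_filter.1 he).2]), sum_const, smul_eq_mul]
    norm_cast
    by_cases hT : T ⊆ L
    · rw [H.count T hT]
      by_cases hlt : #T < h
      · obtain ⟨j, hj⟩ : ∃ j, h - #T = j + 1 := ⟨h - #T - 1, by omega⟩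
        rw [if_pos hlt.le, if_pos (And.intro hT hlt), hj, Nat.add_sub_cancel, mul_comm (r.choose j),
          Nat.add_one_mul_choose_eq]
      · have : h - #T = 0 := by omega
        simp [this, hlt]
    · rw [if_neg fun hn => hT hn.1, filter_false_of_mem]
      · simp
      · rintro e - rfl
        exact hT (H.subset e)
  obtain ⟨k, hk⟩ : ∃ k : Quotient st → K, ∀ e, k (Quotient.mk st e) = col e :=
    ⟨Quotient.lift col fun _ _ h => col_eq_of_eqvGen h, fun _ => rfl⟩
  obtain ⟨X, hX1, hX2, hX3⟩ := exists_finset_rounding (C := Quotient st) (Quotient.mk st)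
    k S x (fun e => by positivity)
    (fun e => by
      rw [div_le_one hr]
      exact_mod_cast (H.card_le e).2) (fun _ => 2) _
    (fun i => by
      simp only [hk]
      rw [hsum, H.hinges i, div_eq_iff hr.ne']
      push_cast
      ring) hq
  refine ⟨X, fun i => by simpa only [hk] using hX1 i, fun T hT => by rw [hX2 T]; simp [hT],
    fun e he e' he' hne hee' => ?_⟩
  by_contra! hle
  have h1 := hX3 (Quotient.mk st e)
  have hcomp : ({a | Quotient.mk st a = Quotient.mk st e} : Finset E) = edgeComponent col S e := by
    ext a
    rw [mem_edgeComponent]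
    simp only [mem_filter, mem_univ, true_and]
    rw [eq_comm]
    exact Quotient.eq
  -- A component with at most `r + 1` hinges has weight at most 1, so it cannot contain two selected
  -- edges.
  have h2 : ⌈∑ a with Quotient.mk st a = Quotient.mk st e, x a⌉ ≤ 1 := by
    rw [hcomp, hsum, Int.ceil_le, Int.cast_one, div_le_one hr]
    exact_mod_cast hle
  have h3 : 1 < #{a ∈ X | Quotient.mk st a = Quotient.mk st e} := by
    refine one_lt_card.2 ⟨e, by simp [he], e', ?_, hne⟩
    refine mem_filter.2 ⟨he', ?_⟩
    have := hcomp.symm ▸ hee'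
    simpa using this
  have : (1 : ℤ) < #{a ∈ X | Quotient.mk st a = Quotient.mk st e} := by exact_mod_cast h3
  omega

theorem sum_sub_card_insert [DecidableEq E] (H : IsPartialFactorization h (r + 1) col L S)
    {w : V} (hw : w ∉ L) (X Y : Finset E) (hX : ∀ e ∈ X, #(S e) < h) :
    ∑ e ∈ Y, (h - #(if e ∈ X then insert w (S e) else S e)) + #(Y ∩ X) =
      ∑ e ∈ Y, (h - #(S e)) := by
  have : #(Y ∩ X) = ∑ e ∈ Y, if e ∈ X then 1 else 0 := by
    rw [← sum_filter, filter_mem_eq_inter]; simp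
  rw [this, ← sum_add_distrib]
  refine sum_congr rfl fun e _ => ?_
  split_ifs with he
  · rw [card_insert_of_notMem fun h => hw (H.subset e h)]
    have := hX e he
    omega
  · rfl

/-- Splitting off one more vertex. -/
theorem IsPartialFactorization.exists_step [Fintype K] [Fintype V]
    (H : IsPartialFactorization h (r + 1) col L S) (h2 : HasTwoHinges h col S) {w : V}
    (hw : w ∉ L) :
    ∃ S' : E → Finset V, IsPartialFactorization h r col (insert w L) S' ∧
      (∀ e, S e ⊆ S' e) ∧ (1 ≤ r → HasTwoHinges h col S') := by
  classical
  obtain ⟨X, hX1, hX2, hX3⟩ := H.exists_selection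
  have hXlt : ∀ e ∈ X, #(S e) < h := by
    intro e he
    by_contra hlt
    have := hX2 (S e) (H.subset e)
    rw [if_neg hlt, card_eq_zero] at this
    exact notMem_empty e (this ▸ (by simpa using he))
  have hwS : ∀ e, w ∉ S e := fun e h => hw (H.subset e h)
  set S' : E → Finset V := fun e => if e ∈ X then insert w (S e) else S e with hS'
  have hSS' : ∀ e, S e ⊆ S' e := by
    intro e; simp only [hS']; split_ifs
    · exact subset_insert _ _
    · exact Subset.rfl
  have hwS' : ∀ e, w ∈ S' e ↔ e ∈ X := by
    intro e; simp only [hS']; split_ifs with he <;> simp [he, hwS]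
  have hvS' : ∀ e, ∀ v ∈ L, (v ∈ S' e ↔ v ∈ S e) := by
    intro e v hv
    have : v ≠ w := fun h => hw (h ▸ hv)
    simp only [hS']; split_ifs with he <;> simp [this]
  have hsum : ∀ Y : Finset E, ∑ e ∈ Y, (h - #(S' e)) + #(Y ∩ X) = ∑ e ∈ Y, (h - #(S e)) :=
    fun Y => sum_sub_card_insert H hw X Y hXlt
  refine ⟨S', ⟨fun e => ?_, fun T hT => ?_, fun i v hv => ?_, fun i => ?_⟩, hSS', fun hr => ?_⟩
  · simp only [hS']; split_ifs
    · exact insert_subset_insert _ (H.subset e)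
    · exact (H.subset e).trans (subset_insert _ _)
  · by_cases hwT : w ∈ T
    · have hTL : T.erase w ⊆ L := by
        intro v hv
        obtain ⟨hvw, hv⟩ := mem_erase.1 hv
        exact (mem_insert.1 (hT hv)).resolve_left hvw
      have hcT : #(T.erase w) + 1 = #T := card_erase_add_one hwT
      have : ({e | S' e = T} : Finset E) = {e ∈ X | S e = T.erase w} := by
        ext e
        simp only [mem_filter, mem_univ, true_and]
        constructor
        · rintro rfl
          have he : e ∈ X := (hwS' e).1 hwT
          refine ⟨he, ?_⟩
          simp [hS', he, hwS]
        · rintro ⟨he, hST⟩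
          simp [hS', he, hST, insert_erase hwT]
      rw [this, hX2 _ hTL]
      by_cases hle : #T ≤ h
      · rw [if_pos (by omega), if_pos hle]
        congr 1; omega
      · rw [if_neg (by omega), if_neg hle]
    · have hTL : T ⊆ L := fun v hv =>
        (mem_insert.1 (hT hv)).resolve_left fun h => hwT (h ▸ hv)
      have : ({e | S' e = T} : Finset E) = ({e | S e = T} : Finset E) \ {e ∈ X | S e = T} := by
        ext e
        simp only [mem_filter, mem_univ, true_and, mem_sdiff]
        constructor
        · rintro rfl
          have he : e ∉ X := fun h => hwT ((hwS' e).2 h)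
          simp [hS', he]
        · rintro ⟨hST, hn⟩
          have he : e ∉ X := fun h => hn ⟨h, hST⟩
          simp [hS', he, hST]
      rw [this, card_sdiff_of_subset (fun e he => by simp at he ⊢; exact he.2), H.count T hTL,
        hX2 T hTL]
      rcases lt_trichotomy (#T) h with hlt | heq | hgt
      -- Pascal's rule: the edges of trace `T` divide into those that receive `w` and those that do
      -- not.
      · obtain ⟨j, hj⟩ : ∃ j, h - #T = j + 1 := ⟨h - #T - 1, by omega⟩
        rw [if_pos hlt.le, if_pos hlt, if_pos hlt.le, hj, Nat.add_sub_cancel,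
          Nat.choose_succ_succ', Nat.add_sub_cancel_left]
      · simp [heq]
      · simp [hgt.not_ge, hgt.le]
  · rcases eq_or_ne v w with rfl | hne
    · rw [← hX1 i]
      congr 1
      ext e
      simp only [mem_filter, mem_univ, true_and, hwS']
      tauto
    · have hvL := (mem_insert.1 hv).resolve_left hne
      rw [← H.degree i v hvL]
      congr 1
      ext e
      simp only [mem_filter, mem_univ, true_and, hvS' e v hvL]
  · have h3 := hsum {e | col e = i}
    have h4 : #(({e | col e = i} : Finset E) ∩ X) = 2 := by
      rw [← hX1 i]
      congr 1
      ext e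
      simp [and_comm]
    rw [H.hinges i, h4] at h3
    omega
  · intro Y hY hsat
    obtain ⟨e₀, he₀⟩ := hY
    set Z : Finset E := {e ∈ Y | col e = col e₀} with hZ
    have hZne : Z.Nonempty := ⟨e₀, by simp [hZ, he₀]⟩
    have hZS' : IsSaturated col S' Z := by
      intro a ha b hab hd
      simp only [hZ, mem_filter] at ha ⊢
      exact ⟨hsat a ha.1 b hab hd, hab ▸ ha.2⟩
    suffices hZ2 : 2 ≤ ∑ e ∈ Z, (h - #(S' e)) from
      hZ2.trans (sum_le_sum_of_subset (filter_subset _ _))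
    have hZS : IsSaturated col S Z := hZS'.mono hSS'
    have h3 := hsum Z
    rcases (Z ∩ X).eq_empty_or_nonempty with h0 | ⟨e, he⟩
    · rw [h0, card_empty, add_zero] at h3
      rw [h3]
      exact h2 Z hZne hZS
    obtain ⟨heZ, heX⟩ := mem_inter.1 he
    have hce : col e = col e₀ := (mem_filter.1 heZ).2
    obtain ⟨e', he', hne⟩ : ∃ e' ∈ ({a ∈ X | col a = col e} : Finset E), e' ≠ e :=
      exists_mem_ne (by rw [hX1]; norm_num) e
    obtain ⟨heX', hce'⟩ := mem_filter.1 he'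
    -- Both selected edges of this colour now contain `w`, so both lie in `Z`. As `Z` loses at most
    -- two hinges, it needs four beforehand.
    have heZ' : e' ∈ Z := hZS' e heZ e' hce'.symm
      (not_disjoint_iff.2 ⟨w, (hwS' e).2 heX, (hwS' e').2 heX'⟩)
    have hle : #(Z ∩ X) ≤ 2 := by
      rw [← hX1 (col e₀)]
      refine card_le_card fun a ha => ?_
      simp only [hZ, mem_inter, mem_filter] at ha ⊢
      exact ⟨ha.2, ha.1.2⟩
    suffices 4 ≤ ∑ e ∈ Z, (h - #(S e)) by omega
    by_cases hcomp : e' ∈ edgeComponent col S e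
    -- `Z` has at least `r + 2` of the `2 * (r + 1)` hinges. This gives four if `r ≥ 2`. If `r = 1`,
    -- a nonempty complement would need two of the four hinges, so `Z` is the whole class.
    · have h4 := hX3 e heX e' heX' hne.symm hcomp
      have h5 : ∑ a ∈ edgeComponent col S e, (h - #(S a)) ≤ ∑ e ∈ Z, (h - #(S e)) :=
        sum_le_sum_of_subset (hZS.edgeComponent_subset heZ)
      have h6 := sum_sdiff (f := fun a => h - #(S a))
        (show Z ⊆ ({a | col a = col e₀} : Finset E) from fun a ha =>
          mem_filter.2 ⟨mem_univ a, (mem_filter.1 ha).2⟩)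
      rw [H.hinges] at h6
      rcases (({a | col a = col e₀} : Finset E) \ Z).eq_empty_or_nonempty with h0 | hcne
      · rw [h0, sum_empty] at h6
        omega
      · have := h2 _ hcne (hZS.color_sdiff (col e₀))
        omega
    · have hdisj : Disjoint (edgeComponent col S e) (edgeComponent col S e') := by
        rw [disjoint_left]
        intro a ha ha'
        rw [mem_edgeComponent] at *
        exact hcomp (ha.trans _ _ _ (.symm _ _ ha'))
      have h4 := h2 _ ⟨e, self_mem_edgeComponent e⟩ (isSaturated_edgeComponent e)
      have h5 := h2 _ ⟨e', self_mem_edgeComponent e'⟩ (isSaturated_edgeComponent e')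
      have h6 : ∑ a ∈ edgeComponent col S e ∪ edgeComponent col S e', (h - #(S a)) ≤
          ∑ e ∈ Z, (h - #(S e)) := sum_le_sum_of_subset
        (union_subset (hZS.edgeComponent_subset heZ) (hZS.edgeComponent_subset heZ'))
      rw [sum_union hdisj] at h6
      omega

/-- All but one vertex can be split off. -/
theorem exists_isPartialFactorization [Fintype K] [Fintype V] (hh : 2 ≤ h)
    (hE : Fintype.card E = (Fintype.card V).choose h)
    (hcol : ∀ i, #{e | col e = i} * h = 2 * Fintype.card V) (r : ℕ) (L : Finset V)
    (hL : #L + (r + 1) = Fintype.card V) :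
    ∃ S : E → Finset V, IsPartialFactorization h (r + 1) col L S ∧ HasTwoHinges h col S := by
  induction L using Finset.induction generalizing r with
  | empty =>
    rw [card_empty, zero_add] at hL
    refine ⟨fun _ => ∅, ⟨fun _ => Subset.rfl, fun T hT => ?_, fun i v hv => ?_, fun i => ?_⟩,
      fun X hX _ => ?_⟩
    · obtain rfl := subset_empty.1 hT
      simp [hE, hL]
    · exact absurd hv (notMem_empty v)
    · simp [hcol, hL]
    · have := hX.card_pos
      simp only [card_empty, Nat.sub_zero, sum_const, smul_eq_mul]
      nlinarith
  | insert w L hw ih =>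
    rw [card_insert_of_notMem hw] at hL
    obtain ⟨S, hS, hS2⟩ := ih (r + 1) (by omega)
    obtain ⟨S', hS', -, hS2'⟩ := hS.exists_step hS2 hw
    exact ⟨S', hS', hS2' (by omega)⟩

/-- Every edge colouring of the right type is realised by a connected `2`-factorization. -/
theorem exists_connected_partial_factorization [Fintype K] [Fintype V] [Nonempty V] (hh : 2 ≤ h)
    (hE : Fintype.card E = (Fintype.card V).choose h)
    (hcol : ∀ i, #{e | col e = i} * h = 2 * Fintype.card V) :
    ∃ S : E → Finset V, IsPartialFactorization h 0 col univ S ∧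
      ∀ i, ∀ X ⊆ ({e | col e = i} : Finset E), X.Nonempty → IsSaturated col S X →
        X = ({e | col e = i} : Finset E) := by
  classical
  obtain ⟨w⟩ := ‹Nonempty V›
  obtain ⟨S, hS, hS2⟩ := exists_isPartialFactorization hh hE hcol 0 (univ.erase w) (by
    rw [card_erase_add_one (mem_univ w), card_univ])
  obtain ⟨S', hS', hSS', -⟩ := hS.exists_step hS2 (notMem_erase w univ)
  rw [insert_erase (mem_univ w)] at hS'
  refine ⟨S', hS', fun i X hXi hX hsat => by_contra fun hne => ?_⟩
  have hsatS := hsat.mono hSS'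
  -- Before the last split a colour has two hinges in all, too few for both `X` and a nonempty
  -- complement.
  have h1 := hS2 X hX hsatS
  have h2 := hS2 _ (sdiff_nonempty.2 fun h => hne (hXi.antisymm h)) (hsatS.color_sdiff i)
  have h3 := sum_sdiff (f := fun a => h - #(S a)) hXi
  rw [hS.hinges] at h3
  omega

end

/-! ### Degree counts, and hypergraphs from incidence data -/

namespace MultiHypergraph

open Finset

variable {V : Type*} [DecidableEq V]

theorem degree_sum {ι : Type*} (s : Finset ι) (F : ι → MultiHypergraph V)
    (G : MultiHypergraph V) (hG : ∑ i ∈ s, (F i).edges = G.edges) (v : V) :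
    G.degree v = ∑ i ∈ s, (F i).degree v := by
  have := map_sum ((Multiset.sumAddMonoidHom (M := ℕ)).comp
    (Multiset.mapAddMonoidHom fun e : Multiset V => e.count v)) (fun i => (F i).edges) s
  rw [hG] at this
  simpa [degree] using this

theorem degree_complete [Fintype V] {h : ℕ} (hh : 1 ≤ h) (v : V) :
    (complete V h).degree v = (Fintype.card V - 1).choose (h - 1) := by
  have h1 : (complete V h).degree v = #{s ∈ powersetCard h (univ : Finset V) | v ∈ s} := by
    simp only [degree, complete, Multiset.map_map, Function.comp_def,
      Multiset.count_eq_of_nodup (nodup _), card_filter]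
    rfl
  have h2 : ({s ∈ powersetCard h (univ : Finset V) | v ∉ s}) = powersetCard h (univ.erase v) := by
    ext s
    simp only [mem_filter, mem_powersetCard, subset_univ, true_and, subset_erase]
    tauto
  have h3 := card_filter_add_card_filter_not (s := powersetCard h (univ : Finset V))
    (fun s => v ∈ s)
  rw [h2, card_powersetCard, card_powersetCard, card_erase_of_mem (mem_univ v), card_univ] at h3
  obtain ⟨n, hn⟩ : ∃ n, Fintype.card V = n + 1 :=
    ⟨_, (Nat.succ_pred_eq_of_pos (Fintype.card_pos_iff.2 ⟨v⟩)).symm⟩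
  obtain ⟨j, rfl⟩ : ∃ j, h = j + 1 := ⟨h - 1, by omega⟩
  rw [hn, Nat.choose_succ_succ', Nat.add_sub_cancel] at h3
  rw [h1, hn, Nat.add_sub_cancel, Nat.add_sub_cancel]
  omega

/-- Handshake lemma. -/
theorem sum_degree [Fintype V] (G : MultiHypergraph V) :
    ∑ v, G.degree v = (G.edges.map Multiset.card).sum := by
  unfold degree
  induction G.edges using Multiset.induction with
  | empty => simp
  | cons e s ih =>
    simp only [Multiset.map_cons, Multiset.sum_cons, sum_add_distrib, ih]
    rw [Multiset.sum_count_eq_card (by simp)]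

theorem card_of_mem_complete {V : Type*} [Fintype V] {h : ℕ} {e : Multiset V}
    (he : e ∈ (complete V h).edges) : e.card = h := by
  obtain ⟨s, hs, rfl⟩ := Multiset.mem_map.1 he
  exact (mem_powersetCard.1 hs).2

theorem arithmetic_of_factorization [Fintype V] {h k : ℕ} (hh : 1 ≤ h) (hn : h < Fintype.card V)
    (F : Fin k → MultiHypergraph V) (hF : IsFactorization (fun _ => 2) F (complete V h)) :
    Even ((Fintype.card V - 1).choose (h - 1)) ∧ h ∣ 2 * Fintype.card V := by
  obtain ⟨v⟩ : Nonempty V := Fintype.card_pos_iff.1 (by omega)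
  have hdeg : (Fintype.card V - 1).choose (h - 1) = k * 2 := by
    rw [← degree_complete hh v, degree_sum univ F _ hF.1,
      sum_congr rfl fun i _ => (hF.2 i).2 v]
    simp
  refine ⟨⟨k, by omega⟩, ?_⟩
  -- Positive degree guarantees a factor to which the handshake lemma applies.
  have hpos : 0 < (Fintype.card V - 1).choose (h - 1) := Nat.choose_pos (by omega)
  have hk : 0 < k := by omega
  have hsum := sum_degree (F ⟨0, hk⟩)
  rw [sum_congr rfl fun v _ => (hF.2 ⟨0, hk⟩).2 v,
    Multiset.map_congr rfl fun e he => card_of_mem_complete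
      (Multiset.mem_of_le (hF.2 ⟨0, hk⟩).1 he)] at hsum
  simp only [sum_const, card_univ, smul_eq_mul, Multiset.map_const', Multiset.sum_replicate] at hsum
  exact ⟨_, by rw [mul_comm 2, hsum, mul_comm]⟩

/-- The colour class of the incidence data `S`. -/
def ofColor {E K : Type*} [Fintype E] [DecidableEq K] (col : E → K) (S : E → Finset V) (i : K) :
    MultiHypergraph V where
  edges := ({e | col e = i} : Finset E).val.map fun e => (S e).val

/-- The count says that `S` is a bijection onto the `h`-subsets, and the colour classes partition
its domain. -/
theorem sum_edges_ofColor {E K : Type*} [Fintype E] [Fintype K] [DecidableEq K] [Fintype V]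
    {h : ℕ} {col : E → K} {S : E → Finset V}
    (hS : ∀ T, #{e | S e = T} = if #T = h then 1 else 0) :
    ∑ i, (ofColor col S i).edges = (complete V h).edges := by
  classical
  have hmap : ∀ s : Finset E, s.val.map (fun e => (S e).val) =
      ∑ e ∈ s, ({(S e).val} : Multiset (Multiset V)) := by
    intro s
    rw [← Multiset.sum_map_singleton (s.val.map fun e => (S e).val), Multiset.map_map]
    rfl
  have hcard : ∀ e, #(S e) = h := by
    intro e
    by_contra hne
    have := hS (S e)
    rw [if_neg hne, card_eq_zero] at this
    exact notMem_empty e (this ▸ (by simp))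
  have hinj : Function.Injective S := by
    intro a b hab
    have := hS (S b)
    rw [if_pos (hcard b)] at this
    exact card_le_one.1 this.le a (by simp [hab]) b (by simp)
  have himg : univ.image S = powersetCard h univ := by
    ext T
    simp only [mem_image, mem_univ, true_and, mem_powersetCard, subset_univ]
    refine ⟨fun ⟨e, he⟩ => he ▸ hcard e, fun hT => ?_⟩
    have := hS T
    rw [if_pos hT] at this
    obtain ⟨e, he⟩ := card_pos.1 (this ▸ Nat.one_pos)
    exact ⟨e, by simpa using he⟩
  simp only [ofColor, hmap]
  rw [sum_fiberwise, ← hmap, complete, ← himg, image_val_of_injOn hinj.injOn, Multiset.map_map]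
  rfl

theorem isFactorization_ofColor {E : Type*} {k : ℕ} [Fintype E] [Fintype V]
    {h : ℕ} {col : E → Fin k} {S : E → Finset V}
    (H : IsPartialFactorization h 0 col univ S) :
    IsFactorization (fun _ => 2) (ofColor col S) (complete V h) := by
  have hsum : ∑ i, (ofColor col S i).edges = (complete V h).edges := by
    refine sum_edges_ofColor fun T => ?_
    rw [H.count T (subset_univ T)]
    rcases lt_trichotomy (#T) h with hlt | heq | hgt
    · rw [if_pos hlt.le, if_neg hlt.ne, Nat.choose_eq_zero_of_lt (by omega)]
    · simp [heq]
    · rw [if_neg (by omega), if_neg (by omega)]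
  refine ⟨hsum, fun i => ⟨hsum ▸ single_le_sum (f := fun i => (ofColor col S i).edges)
    (fun _ _ => Multiset.zero_le _) (mem_univ i), fun v => ?_⟩⟩
  rw [← H.degree i v (mem_univ v), ← filter_filter, card_filter]
  simp only [degree, ofColor, Multiset.map_map, Function.comp_def,
      Multiset.count_eq_of_nodup (nodup _)]
  rfl

/-- The edges of colour `i` that meet the vertices reachable from `u` form a nonempty saturated set,
hence the whole class. -/
theorem isConnected_ofColor {E K : Type*} [Fintype E] [Fintype V] [Nonempty V]
    [DecidableEq K] {h : ℕ} {col : E → K} {S : E → Finset V}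
    (H : IsPartialFactorization h 0 col univ S) (i : K)
    (hc : ∀ X ⊆ ({e | col e = i} : Finset E), X.Nonempty → IsSaturated col S X →
      X = ({e | col e = i} : Finset E)) :
    (ofColor col S i).IsConnected := by
  classical
  refine ⟨‹_›, fun u v => ?_⟩
  have hmem : ∀ x : V, ∃ e, col e = i ∧ x ∈ S e := by
    intro x
    have := H.degree i x (mem_univ x)
    obtain ⟨e, he⟩ := card_pos.1 (this ▸ Nat.two_pos)
    exact ⟨e, by simpa using he⟩
  have hlink : ∀ e, col e = i → ∀ x ∈ S e, ∀ y ∈ S e, (ofColor col S i).Linked x y :=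
    fun e he x hx y hy => ⟨(S e).val,
      Multiset.mem_map.2 ⟨e, mem_filter.2 ⟨mem_univ e, he⟩, rfl⟩, hx, hy⟩
  have hX := hc {e | col e = i ∧ ∃ x ∈ S e, Relation.ReflTransGen (ofColor col S i).Linked u x}
    (fun e he => by
      simp only [mem_filter, mem_univ, true_and] at he ⊢
      exact he.1)
    (by
      obtain ⟨e, he, hu⟩ := hmem u
      exact ⟨e, mem_filter.2 ⟨mem_univ e, he, u, hu, .refl⟩⟩)
    (by
      intro e he e' hcol hd
      simp only [mem_filter, mem_univ, true_and] at he ⊢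
      obtain ⟨hei, x, hx, hux⟩ := he
      obtain ⟨y, hy, hy'⟩ := not_disjoint_iff.1 hd
      exact ⟨hcol ▸ hei, y, hy', hux.tail (hlink e hei x hx y hy)⟩)
  obtain ⟨e, he, hv⟩ := hmem v
  have : e ∈ ({e | col e = i} : Finset E) := mem_filter.2 ⟨mem_univ e, he⟩
  rw [← hX] at this
  obtain ⟨-, -, x, hx, hux⟩ := mem_filter.1 this
  exact hux.tail (hlink e he x hx v hv)

theorem isConnectedFactorizable_complete [Fintype V] {h : ℕ} (hh : 1 ≤ h)
    (hn : h < Fintype.card V) (heven : Even ((Fintype.card V - 1).choose (h - 1)))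
    (hdvd : h ∣ 2 * Fintype.card V) : IsConnectedFactorizable 2 (complete V h) := by
  have : Nonempty V := Fintype.card_pos_iff.1 (by omega)
  have h2 : 2 ≤ h := by
    by_contra hlt
    -- For `h = 1` the binomial coefficient is 1, which is odd.
    obtain rfl : h = 1 := by omega
    simp at heven
  obtain ⟨k, hk⟩ := heven
  obtain ⟨m, hm⟩ := hdvd
  -- Here `k` is the number of factors and `m` the number of edges in each.
  have hE : Fintype.card (Fin k × Fin m) = (Fintype.card V).choose h := by
    obtain ⟨n, hn'⟩ : ∃ n, Fintype.card V = n + 1 := ⟨Fintype.card V - 1, by omega⟩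
    obtain ⟨j, rfl⟩ : ∃ j, h = j + 1 := ⟨h - 1, by omega⟩
    rw [hn'] at hk hm ⊢
    have := Nat.add_one_mul_choose_eq n j
    simp only [Nat.add_sub_cancel] at hk
    rw [Fintype.card_prod, Fintype.card_fin, Fintype.card_fin]
    refine Nat.eq_of_mul_eq_mul_right (Nat.succ_pos j) ?_
    rw [Nat.succ_eq_add_one, ← this, hk, mul_assoc, mul_comm m, ← hm]
    ring
  obtain ⟨S, hS, hc⟩ := exists_connected_partial_factorization (V := V)
    (col := (Prod.fst : Fin k × Fin m → Fin k)) h2 hE fun i => by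
      have : ({e | e.1 = i} : Finset (Fin k × Fin m)) = {i} ×ˢ univ := by
        ext ⟨a, b⟩; simp [eq_comm]
      rw [this, card_product, card_singleton, card_univ, Fintype.card_fin, hm]
      ring
  exact ⟨k, ofColor Prod.fst S, isFactorization_ofColor hS,
    fun i => isConnected_ofColor hS i (hc i)⟩

end MultiHypergraph

/-! ### Connected 2-factors of complete graphs as Hamiltonian cycles -/

namespace MultiHypergraph

open Finset

variable {V : Type*} [DecidableEq V]

/-- The simple graph whose edges are the two-element edges of a hypergraph. -/
def toSimpleGraph (G : MultiHypergraph V) : SimpleGraph V where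
  Adj u v := u ≠ v ∧ ({u, v} : Multiset V) ∈ G.edges
  symm := ⟨fun u v h => ⟨h.1.symm, Multiset.pair_comm u v ▸ h.2⟩⟩
  loopless := ⟨fun _ h => h.1 rfl⟩

theorem nodup_edges_complete {V : Type*} [Fintype V] (h : ℕ) : (complete V h).edges.Nodup :=
  (nodup _).map val_injective

theorem pair_mem_edges_complete [Fintype V] {u v : V} (huv : u ≠ v) :
    ({u, v} : Multiset V) ∈ (complete V 2).edges :=
  Multiset.mem_map.2 ⟨{u, v}, mem_powersetCard.2 ⟨subset_univ _, card_pair huv⟩, by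
    rw [insert_val_of_notMem (by simpa using huv)]; rfl⟩

theorem nodup_of_mem_complete {V : Type*} [Fintype V] {h : ℕ} {e : Multiset V}
    (he : e ∈ (complete V h).edges) : e.Nodup := by
  obtain ⟨s, -, rfl⟩ := Multiset.mem_map.1 he
  exact s.nodup

theorem exists_eq_pair {V : Type*} [Fintype V] {e : Multiset V} (he : e ∈ (complete V 2).edges) {u : V}
    (hu : u ∈ e) : ∃ v, u ≠ v ∧ e = {u, v} := by
  obtain ⟨t, rfl⟩ := Multiset.exists_cons_of_mem hu
  have hc := card_of_mem_complete he
  rw [Multiset.card_cons] at hc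
  obtain ⟨v, rfl⟩ := Multiset.card_eq_one.1 (by omega : t.card = 1)
  refine ⟨v, ?_, rfl⟩
  rintro rfl
  simpa using nodup_of_mem_complete he

/-- Edges below those of the complete graph are simple pairs without repetition, so passing to a
simple graph loses no degree. -/
theorem ncard_neighborSet_toSimpleGraph [Fintype V] {F : MultiHypergraph V}
    (hF : F.edges ≤ (complete V 2).edges) (u : V) :
    (F.toSimpleGraph.neighborSet u).ncard = F.degree u := by
  have hnd : F.edges.Nodup := Multiset.nodup_of_le hF (nodup_edges_complete 2)
  have h1 : F.degree u = #{e ∈ F.edges.toFinset | u ∈ e} := by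
    rw [degree, card_filter, Finset.sum, Multiset.toFinset_val, hnd.dedup]
    refine congrArg _ (Multiset.map_congr rfl fun e he => ?_)
    exact Multiset.count_eq_of_nodup (nodup_of_mem_complete (Multiset.mem_of_le hF he))
  have h2 : ((({e ∈ F.edges.toFinset | u ∈ e} : Finset (Multiset V)) : Set (Multiset V))) =
      (fun v => ({u, v} : Multiset V)) '' F.toSimpleGraph.neighborSet u := by
    ext e
    simp only [coe_filter, Multiset.mem_toFinset, Set.mem_ofPred_eq, Set.mem_image,
      SimpleGraph.mem_neighborSet]
    constructor
    · rintro ⟨he, hu⟩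
      obtain ⟨v, huv, rfl⟩ := exists_eq_pair (Multiset.mem_of_le hF he) hu
      exact ⟨v, ⟨huv, he⟩, rfl⟩
    · rintro ⟨v, hv, rfl⟩
      exact ⟨hv.2, by simp⟩
  rw [h1, ← Set.ncard_coe_finset, h2, Set.ncard_image_of_injective]
  intro a b hab
  simpa using (Multiset.cons_inj_right u).1 hab

theorem reachable_toSimpleGraph [Fintype V] {F : MultiHypergraph V}
    (hF : F.edges ≤ (complete V 2).edges) (hc : F.IsConnected) (u v : V) :
    F.toSimpleGraph.Reachable u v := by
  induction hc.2 u v with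
  | refl => exact .refl _
  | @tail a b _ hab ih =>
    refine ih.trans ?_
    obtain ⟨e, he, ha, hb⟩ := hab
    obtain ⟨c, hac, rfl⟩ := exists_eq_pair (Multiset.mem_of_le hF he) ha
    rcases Multiset.mem_cons.1 hb with rfl | hb
    · exact .refl _
    · rw [Multiset.mem_singleton.1 hb]
      exact SimpleGraph.Adj.reachable ⟨hac, he⟩

/-- A connected `2`-factor of the complete graph is a Hamiltonian cycle. -/
theorem exists_isHamiltonianCycle [Fintype V] {F : MultiHypergraph V}
    (hF : IsFactor 2 F (complete V 2)) (hc : F.IsConnected) (u : V) :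
    ∃ c : (⊤ : SimpleGraph V).Walk u u, c.IsHamiltonianCycle ∧
      ∀ a b, s(a, b) ∈ c.edges ↔ F.toSimpleGraph.Adj a b := by
  have hdeg : ∀ v, (F.toSimpleGraph.neighborSet v).ncard = 2 := fun v =>
    (ncard_neighborSet_toSimpleGraph hF.1 v).trans (hF.2 v)
  have hcyc : F.toSimpleGraph.IsCycles := fun v _ => hdeg v
  obtain ⟨p, hp, hverts⟩ := hcyc.exists_cycle_toSubgraph_verts_eq_connectedComponentSupp
    (c := F.toSimpleGraph.connectedComponentMk u) (v := u) (by simp)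
    (Set.nonempty_of_ncard_ne_zero (by rw [hdeg]; norm_num))
  have hsupp : ∀ v, v ∈ p.support := by
    intro v
    rw [← SimpleGraph.Walk.mem_verts_toSubgraph, hverts, SimpleGraph.ConnectedComponent.mem_supp_iff,
      SimpleGraph.ConnectedComponent.eq]
    exact reachable_toSimpleGraph hF.1 hc v u
  have hadj : ∀ a b, s(a, b) ∈ p.edges ↔ F.toSimpleGraph.Adj a b := by
    intro a b
    refine ⟨fun h => p.adj_of_mem_edges h, fun h => ?_⟩
    -- The cycle and the factor both have degree 2 at `a`, so inclusion of neighbour sets forces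
    -- equality.
    have heq : p.toSubgraph.neighborSet a = F.toSimpleGraph.neighborSet a := by
      refine Set.eq_of_subset_of_ncard_le (p.toSubgraph.neighborSet_subset a) ?_ (Set.toFinite _)
      rw [hdeg, hp.ncard_neighborSet_toSubgraph_eq_two (hsupp a)]
    have hb : b ∈ p.toSubgraph.neighborSet a := heq ▸ h
    rw [← SimpleGraph.Walk.mem_edges_toSubgraph]
    exact hb
  have hham : p.IsHamiltonianCycle := by
    rw [SimpleGraph.Walk.isHamiltonianCycle_iff_isCycle_and_support_count_tail_eq_one]
    refine ⟨hp, fun a => List.count_eq_one_of_mem hp.support_nodup ?_⟩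
    have := hsupp a
    rw [SimpleGraph.Walk.mem_support_iff] at this
    rcases this with rfl | h
    · exact SimpleGraph.Walk.end_mem_tail_support hp.not_nil
    · exact h
  refine ⟨p.mapLe le_top, ?_, fun a b => ?_⟩
  · exact hham.map (f := SimpleGraph.Hom.ofLE le_top) Function.bijective_id
  · rw [SimpleGraph.Walk.edges_mapLe_eq_edges, hadj]

theorem hasHamiltonianDecomposition_of_isConnectedFactorizable [Fintype V] [Nonempty V]
    (H : IsConnectedFactorizable 2 (complete V 2)) :
    HasHamiltonianDecomposition (⊤ : SimpleGraph V) := by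
  obtain ⟨k, F, hF, hc⟩ := H
  obtain ⟨u⟩ := ‹Nonempty V›
  choose c hham hadj using fun i => exists_isHamiltonianCycle (hF.2 i) (hc i) u
  refine ⟨k, fun _ => u, c, hham, fun e => ?_⟩
  induction e with
  | h a b =>
  intro hab
  have hne : a ≠ b := by simpa using hab
  -- Total multiplicity one gives both existence and uniqueness of the cycle through the edge.
  have hcount : ∑ i, (F i).edges.count {a, b} = 1 := by
    rw [← Multiset.count_sum', hF.1]
    exact Multiset.count_eq_one_of_mem (nodup_edges_complete 2) (pair_mem_edges_complete hne)
  have hmem : ∀ i, s(a, b) ∈ (c i).edges ↔ 0 < (F i).edges.count {a, b} := by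
    intro i
    rw [hadj, Multiset.count_pos]
    exact and_iff_right hne
  obtain ⟨i, -, hi⟩ := exists_ne_zero_of_sum_ne_zero (hcount.trans_ne one_ne_zero)
  refine ⟨i, (hmem i).2 (Nat.pos_of_ne_zero hi), fun j hj => by_contra fun hij => ?_⟩
  have hle := sum_le_sum_of_subset (f := fun i => (F i).edges.count {a, b}) (subset_univ {j, i})
  rw [sum_pair hij, hcount] at hle
  have := (hmem j).1 hj
  omega

end MultiHypergraph

-- Each cycle has as many edges as there are vertices, so `k` cycles give `n * k = n * (n - 1) / 2`,
-- that is, `n = 2 * k + 1`.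
open Finset in
theorem odd_card_of_hasHamiltonianDecomposition {V : Type*} [Fintype V] [DecidableEq V]
    [Nonempty V] (H : HasHamiltonianDecomposition (⊤ : SimpleGraph V)) :
    Odd (Fintype.card V) := by
  obtain ⟨k, a, c, hham, huniq⟩ := H
  have h1 : ∀ i, #(c i).edges.toFinset = Fintype.card V := fun i => by
    rw [List.toFinset_card_of_nodup (hham i).isCycle.isCircuit.isTrail.edges_nodup,
      SimpleGraph.Walk.length_edges, (hham i).length_eq]
  have h2 : (univ : Finset (Fin k)).biUnion (fun i => (c i).edges.toFinset) =
      (⊤ : SimpleGraph V).edgeFinset := by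
    ext e
    simp only [mem_biUnion, mem_univ, true_and, List.mem_toFinset, SimpleGraph.mem_edgeFinset]
    exact ⟨fun ⟨i, hi⟩ => (c i).edges_subset_edgeSet hi, fun he => (huniq e he).exists⟩
  have h3 := card_biUnion (s := (univ : Finset (Fin k))) (t := fun i => (c i).edges.toFinset)
    (fun i _ j _ hij => by
      refine disjoint_left.2 fun e hi hj => ?_
      rw [List.mem_toFinset] at hi hj
      exact hij ((huniq e ((c i).edges_subset_edgeSet hi)).unique hi hj))
  rw [h2, SimpleGraph.card_edgeFinset_top_eq_card_choose_two, sum_congr rfl fun i _ => h1 i] at h3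
  simp only [sum_const, card_univ, Fintype.card_fin, smul_eq_mul] at h3
  obtain ⟨n, hn⟩ : ∃ n, Fintype.card V = n + 1 :=
    ⟨_, (Nat.succ_pred_eq_of_pos Fintype.card_pos).symm⟩
  rw [hn] at h3 ⊢
  have h4 := Nat.add_one_mul_choose_eq n 1
  rw [Nat.choose_one_right, h3] at h4
  have h5 : n = 2 * k := by
    refine Nat.eq_of_mul_eq_mul_left (Nat.succ_pos n) ?_
    rw [Nat.succ_eq_add_one, h4]
    ring
  exact ⟨k, by omega⟩

theorem corollary4 {V : Type*} [Fintype V] [DecidableEq V] (n h : ℕ)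
    (hV : Fintype.card V = n) (hh : 1 ≤ h) (hn : h < n) :
    (MultiHypergraph.IsConnectedFactorizable 2 (MultiHypergraph.complete V h) ↔
      Even ((n - 1).choose (h - 1)) ∧ h ∣ 2 * n) ∧
    (h = 2 → (HasHamiltonianDecomposition (⊤ : SimpleGraph V) ↔ Odd n)) := by
  subst hV
  have : Nonempty V := Fintype.card_pos_iff.1 (by omega)
  refine ⟨⟨fun ⟨_, F, hF, _⟩ => MultiHypergraph.arithmetic_of_factorization hh hn F hF,
    fun ⟨h1, h2⟩ => MultiHypergraph.isConnectedFactorizable_complete hh hn h1 h2⟩, ?_⟩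
  rintro rfl
  refine ⟨odd_card_of_hasHamiltonianDecomposition, fun ⟨m, hm⟩ => ?_⟩
  refine MultiHypergraph.hasHamiltonianDecomposition_of_isConnectedFactorizable
    (MultiHypergraph.isConnectedFactorizable_complete hh hn ?_ (dvd_mul_right 2 _))
  rw [hm]
  simp
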